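/- Let $d\ge 1$ be an integer, let $S^{d-1}$ be the Euclidean unit sphere of $\mathbb{R}^d$, let $\alpha\in[0,2)$, let $\beta:S^{d-1}\to(0,\infty)$ be Borel measurable, and let $\lambda$ be a finite Borel measure on $S^{d-1}$. Let $\mu$ be an $\mathcal{E}T\alpha S(\alpha,\beta,\lambda)$ law, that is, an infinitely divisible probability measure on $\mathbb{R}^d$ without Gaussian part (with arbitrary drift) whose Lévy measure is $$\nu(E)=\int_{S^{d-1}}\int_0^\infty \mathbf{1}_E(r w)\,\frac{e^{-\beta(w)r}}{r^{\alpha+1}}\,dr\,\lambda(dw),\qquad E\subseteq\mathbb{R}^d \text{ Borel}.$$ Then: 1. $\mu$ is absolutely continuous with respect to Lebesgue measure on $\mathbb{R}^d$ if and only if the support of $\lambda$ contains $d$ linearly independent vectors. 2. If $X=(X_1,\dots,X_d)$ is a random vector with law $\mu$, then the components $X_1,\dots,X_d$ are mutually independent if and only if the support of $\lambda$ is contained in $\{e_1,-e_1,\dots,e_d,-e_d\}$, where $e_1,\dots,e_d$ is the canonical basis of $\mathbb{R}^d$. -/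

import Mathlib

open MeasureTheory ProbabilityTheory
open scoped RealInnerProductSpace

/-- The unit sphere `S^{d-1}` of `ℝ^d` with the Euclidean norm, as a type. -/
abbrev UnitSphere (d : ℕ) : Type :=
  Metric.sphere (0 : EuclideanSpace ℝ (Fin d)) 1

/-- `μ` is infinitely divisible: for every `n ≥ 1` it is the law of the sum of `n` independent
random vectors with a common law. -/
def IsInfinitelyDivisible {d : ℕ} (μ : Measure (EuclideanSpace ℝ (Fin d))) : Prop :=
  ∀ n : ℕ, 1 ≤ n → ∃ ρ : Measure (EuclideanSpace ℝ (Fin d)), IsProbabilityMeasure ρ ∧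
    (Measure.pi (fun _ : Fin n => ρ)).map (fun x => ∑ i, x i) = μ

/-- `ν` is a Lévy measure: it does not charge the origin and `∫ min(1, ‖x‖²) ν(dx) < ∞`. -/
def IsLevyMeasure {d : ℕ} (ν : Measure (EuclideanSpace ℝ (Fin d))) : Prop :=
  ν {0} = 0 ∧ ∫⁻ x, ENNReal.ofReal (min 1 (‖x‖ ^ 2)) ∂ν < ⊤

/-- The integrand `e^{i⟨z,x⟩} - 1 - i⟨z,x⟩ 1_{‖x‖ ≤ 1}` of the Lévy–Khintchine formula. -/
noncomputable def levyKhintchineIntegrand {d : ℕ} (z x : EuclideanSpace ℝ (Fin d)) : ℂ :=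
  Complex.exp (Complex.I * (⟪z, x⟫ : ℝ)) - 1
    - Set.indicator {y : EuclideanSpace ℝ (Fin d) | ‖y‖ ≤ 1}
        (fun y => Complex.I * (⟪z, y⟫ : ℝ)) x

/-- `μ` is infinitely divisible with drift `γ`, Gaussian covariance matrix `A` and Lévy measure
`ν`, i.e. its characteristic function is given by the Lévy–Khintchine formula with the
generating triplet `(A, ν, γ)`. -/
structure HasLevyTriplet {d : ℕ} (μ : Measure (EuclideanSpace ℝ (Fin d)))
    (A : Matrix (Fin d) (Fin d) ℝ) (ν : Measure (EuclideanSpace ℝ (Fin d)))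
    (γ : EuclideanSpace ℝ (Fin d)) : Prop where
  isProbabilityMeasure : IsProbabilityMeasure μ
  isInfinitelyDivisible : IsInfinitelyDivisible μ
  posSemidef : A.PosSemidef
  isLevyMeasure : IsLevyMeasure ν
  charFun_eq : ∀ z : EuclideanSpace ℝ (Fin d),
    charFun μ z = Complex.exp (Complex.I * (⟪γ, z⟫ : ℝ)
      - ((1 / 2 * ∑ i, ∑ j, z i * A i j * z j : ℝ) : ℂ)
      + ∫ x, levyKhintchineIntegrand z x ∂ν)

/-- The measure `ν(E) = ∫_{S^{d-1}} ∫_0^∞ 1_E(r w) e^{-β(w) r} / r^{α+1} dr lam(dw)`, built as the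
image under `(w, r) ↦ r w` of the measure `e^{-β(w) r} / r^{α+1} lam(dw) dr` on
`S^{d-1} × (0, ∞)`. -/
noncomputable def etsLevyMeasure {d : ℕ} (α : ℝ) (β : UnitSphere d → ℝ)
    (lam : Measure (UnitSphere d)) : Measure (EuclideanSpace ℝ (Fin d)) :=
  ((lam.prod (volume.restrict (Set.Ioi (0 : ℝ)))).withDensity
      (fun p => ENNReal.ofReal (Real.exp (-β p.1 * p.2) / p.2 ^ (α + 1)))).map
    (fun p => p.2 • (p.1 : EuclideanSpace ℝ (Fin d)))

theorem etsLevyMeasure_apply {d : ℕ} (α : ℝ) {β : UnitSphere d → ℝ} (hβ : Measurable β)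
    (lam : Measure (UnitSphere d)) [IsFiniteMeasure lam]
    {E : Set (EuclideanSpace ℝ (Fin d))} (hE : MeasurableSet E) :
    etsLevyMeasure α β lam E =
      ∫⁻ w, (∫⁻ r in Set.Ioi (0 : ℝ),
        E.indicator 1 (r • (w : EuclideanSpace ℝ (Fin d))) *
          ENNReal.ofReal (Real.exp (-β w * r) / r ^ (α + 1))) ∂lam := by
  have hm : Measurable
      (fun p : UnitSphere d × ℝ => p.2 • (p.1 : EuclideanSpace ℝ (Fin d))) := by fun_prop
  have hf : Measurable (fun p : UnitSphere d × ℝ =>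
      ENNReal.ofReal (Real.exp (-β p.1 * p.2) / p.2 ^ (α + 1))) := by fun_prop
  have hi : Measurable (fun p : UnitSphere d × ℝ =>
      E.indicator (1 : EuclideanSpace ℝ (Fin d) → ENNReal)
        (p.2 • (p.1 : EuclideanSpace ℝ (Fin d)))) :=
    (measurable_one.indicator hE).comp hm
  have key := lintegral_prod (μ := lam) (ν := volume.restrict (Set.Ioi (0 : ℝ))) _
    (hi.mul hf).aemeasurable
  simp only [Pi.mul_apply] at key
  rw [etsLevyMeasure, Measure.map_apply hm hE, withDensity_apply _ (hm hE),
    ← lintegral_indicator (hm hE), ← key]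
  refine lintegral_congr fun p => ?_
  by_cases hp : p.2 • (p.1 : EuclideanSpace ℝ (Fin d)) ∈ E <;> simp [Set.indicator, hp]

/-- `μ ∼ ETαS(α, β, lam)`: the exponential tempered stable law with parameters `α ∈ [0, 2)`,
`β : S^{d-1} → (0, ∞)` Borel and `lam` a finite measure on `S^{d-1}`. It is infinitely divisible,
has no Gaussian part, an arbitrary drift, and the Lévy measure `etsLevyMeasure α β lam`. -/
structure IsExpTemperedStable {d : ℕ} (α : ℝ) (β : UnitSphere d → ℝ)
    (lam : Measure (UnitSphere d)) (μ : Measure (EuclideanSpace ℝ (Fin d))) : Prop where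
  alpha_mem : α ∈ Set.Ico (0 : ℝ) 2
  measurable_beta : Measurable β
  beta_pos : ∀ w, 0 < β w
  isFiniteMeasure : IsFiniteMeasure lam
  hasLevyTriplet : ∃ γ : EuclideanSpace ℝ (Fin d),
    HasLevyTriplet μ 0 (etsLevyMeasure α β lam) γ

/-! Sufficiency in 1. If the support of λ contains independent vectors w_j, pick neighbourhoods U_j
such that any choice of directions from them stays independent. Jumps with direction in U_j and size
above 1/(n+1) have finite Lévy mass, so they split off from μ as compound Poisson factors. Each
factor is e^{-mass} δ₀ plus a convolution having the jump measure as a factor. The convolution of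
the d jump measures is absolutely continuous, because for fixed directions (r_j) ↦ ∑ r_j w_j is a
linear isomorphism. Hence a Lebesgue-null set has μ-mass at most ∑ e^{-mass_j}. The masses tend to
infinity, since r^{-α-1} is not integrable at 0 when α ≥ 0. The remaining factor must be a genuine
law; it comes from truncated compound Poisson laws and Lévy's continuity theorem.

Necessity in 1. If the support does not span, some z ≠ 0 is orthogonal to all jumps, so ⟨z, X⟩ is
constant and μ lives on a hyperplane.

Part 2. Independence means that the characteristic function factors along the coordinate axes. Jumps
along the axes make the exponent additive. Conversely, taking moduli, z ↦ ∫ (cos⟨z,x⟩ - 1) ν(dx) is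
additive over coordinates. Comparing e_i + e_j with e_i - e_j gives ∫ (1 - cos x_i)(1 - cos x_j) dν
= 0. Along a ray with small radius this forces w_i w_j = 0 for λ-almost every w, hence on the
support. -/

/-! ### Lévy's continuity theorem. -/

section LevyContinuity

variable {E : Type*} [NormedAddCommGroup E] [InnerProductSpace ℝ E] [FiniteDimensional ℝ E]
  [MeasurableSpace E] [BorelSpace E]

/-- **Lévy's continuity theorem**: a pointwise limit of characteristic functions that is continuous
at `0` is a characteristic function. -/
theorem exists_charFun_eq_of_tendsto {μ : ℕ → Measure E} [∀ n, IsProbabilityMeasure (μ n)]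
    {f : E → ℂ} (hf : ContinuousAt f 0)
    (h : ∀ t, Filter.Tendsto (fun n => charFun (μ n) t) Filter.atTop (nhds (f t))) :
    ∃ ρ : Measure E, IsProbabilityMeasure ρ ∧ ∀ t, charFun ρ t = f t := by
  have htight := isTightMeasureSet_of_tendsto_charFun hf h
  let p : ℕ → ProbabilityMeasure E := fun n => ⟨μ n, inferInstance⟩
  have hcomp : IsCompact (closure (Set.range p)) := by
    refine isCompact_closure_of_isTightMeasureSet (htight.subset ?_)
    rintro _ ⟨_, ⟨n, rfl⟩, rfl⟩
    exact ⟨n, rfl⟩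
  -- Compactness along a nonprincipal ultrafilter gives a limit law without extracting a
  -- subsequence.
  let U : Ultrafilter ℕ := Filter.hyperfilter ℕ
  have hU : (U : Filter ℕ) ≤ Filter.atTop := Nat.hyperfilter_le_atTop
  obtain ⟨ρ, -, hρ⟩ := hcomp.ultrafilter_le_nhds (U.map p)
    (by
      rw [Filter.le_principal_iff, Ultrafilter.mem_coe, Ultrafilter.mem_map]
      exact Filter.univ_mem' fun n => subset_closure ⟨n, rfl⟩)
  have hρ' : Filter.Tendsto p U (nhds ρ) := hρ
  refine ⟨ρ, inferInstance, fun t => ?_⟩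
  rw [ProbabilityMeasure.tendsto_iff_forall_integral_rclike_tendsto ℂ] at hρ'
  have h1 := hρ' (BoundedContinuousFunction.innerProbChar t)
  simp_rw [charFun_eq_integral_innerProbChar] at h ⊢
  exact tendsto_nhds_unique h1 ((h t).mono_left hU)

end LevyContinuity

/-! ### Compound Poisson laws. -/

section CompoundPoisson

variable {E : Type*} [NormedAddCommGroup E] [InnerProductSpace ℝ E] [FiniteDimensional ℝ E]
  [MeasurableSpace E] [BorelSpace E]

/-- The `k`-fold convolution power of a measure. -/
noncomputable def convPow (m : Measure E) : ℕ → Measure E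
  | 0 => Measure.dirac 0
  | k + 1 => m ∗ convPow m k

instance isFiniteMeasure_convPow (m : Measure E) [IsFiniteMeasure m] (k : ℕ) :
    IsFiniteMeasure (convPow m k) := by
  induction k with
  | zero => simp only [convPow]; infer_instance
  | succ k ih => simp only [convPow]; infer_instance

theorem conv_univ (m n : Measure E) [SFinite m] [SFinite n] :
    (m ∗ n) Set.univ = m Set.univ * n Set.univ := by
  rw [Measure.conv, Measure.map_apply (by fun_prop) MeasurableSet.univ, Set.preimage_univ,
    ← Set.univ_prod_univ, Measure.prod_prod]

theorem convPow_univ (m : Measure E) [IsFiniteMeasure m] (k : ℕ) :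
    convPow m k Set.univ = m Set.univ ^ k := by
  induction k with
  | zero => simp [convPow]
  | succ k ih => rw [convPow, conv_univ, ih, pow_succ']

theorem charFun_convPow (m : Measure E) [IsFiniteMeasure m] (k : ℕ) (z : E) :
    charFun (convPow m k) z = charFun m z ^ k := by
  induction k with
  | zero => simp [convPow]
  | succ k ih => rw [convPow, charFun_conv, ih, pow_succ']

/-- The compound Poisson law with finite jump measure `m`. -/
noncomputable def compoundPoisson (m : Measure E) : Measure E :=
  Measure.sum fun k : ℕ =>
    ENNReal.ofReal (Real.exp (-m.real Set.univ) / k.factorial) • convPow m k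

/-- The measure `σ` such that the compound Poisson law with jump measure `m` is
`e^{-m(E)} δ₀ + m ∗ σ`. -/
noncomputable def compoundPoissonTail (m : Measure E) : Measure E :=
  Measure.sum fun k : ℕ =>
    ENNReal.ofReal (Real.exp (-m.real Set.univ) / (k + 1).factorial) • convPow m k

theorem tsum_poisson_weights (c : ℝ) (hc : 0 ≤ c) :
    ∑' k : ℕ, ENNReal.ofReal (Real.exp (-c) / k.factorial) * ENNReal.ofReal c ^ k = 1 := by
  have h0 := NormedSpace.expSeries_div_hasSum_exp (𝔸 := ℝ) c
  rw [← Real.exp_eq_exp_ℝ] at h0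
  have h := h0.mul_left (Real.exp (-c))
  rw [← Real.exp_add, neg_add_cancel, Real.exp_zero] at h
  rw [← ENNReal.ofReal_one, ← h.tsum_eq, ENNReal.ofReal_tsum_of_nonneg (fun n => by positivity)
    h.summable]
  refine tsum_congr fun k => ?_
  rw [← ENNReal.ofReal_pow hc, ← ENNReal.ofReal_mul (by positivity)]
  congr 1
  ring

instance isProbabilityMeasure_compoundPoisson (m : Measure E) [IsFiniteMeasure m] :
    IsProbabilityMeasure (compoundPoisson m) := by
  constructor
  rw [compoundPoisson, Measure.sum_apply _ MeasurableSet.univ]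
  simp only [Measure.smul_apply, convPow_univ, smul_eq_mul]
  convert! tsum_poisson_weights (m.real Set.univ) measureReal_nonneg
  simp

instance isFiniteMeasure_compoundPoissonTail (m : Measure E) [IsFiniteMeasure m] :
    IsFiniteMeasure (compoundPoissonTail m) := by
  constructor
  refine lt_of_le_of_lt ?_ (measure_lt_top (compoundPoisson m) Set.univ)
  rw [compoundPoisson, compoundPoissonTail, Measure.sum_apply _ MeasurableSet.univ,
    Measure.sum_apply _ MeasurableSet.univ]
  refine ENNReal.tsum_le_tsum fun k => ?_
  simp only [Measure.smul_apply, smul_eq_mul]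
  gcongr
  exact Nat.le_succ k

/-- The atom is the term with no jump; every other term of the series contains a factor `m`, which
can later supply absolute continuity. -/
theorem compoundPoisson_eq_add (m : Measure E) [IsFiniteMeasure m] :
    compoundPoisson m = ENNReal.ofReal (Real.exp (-m.real Set.univ)) • Measure.dirac 0
      + m ∗ compoundPoissonTail m := by
  have h : m ∗ compoundPoissonTail m = Measure.sum fun k : ℕ =>
      ENNReal.ofReal (Real.exp (-m.real Set.univ) / (k + 1).factorial) • convPow m (k + 1) := by
    have : m ∗ compoundPoissonTail m = Measure.sum fun k : ℕ =>
        m ∗ (ENNReal.ofReal (Real.exp (-m.real Set.univ) / (k + 1).factorial) • convPow m k) := by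
      rw [compoundPoissonTail, Measure.conv, Measure.prod_sum_right,
        Measure.map_sum (by fun_prop)]
      rfl
    rw [this]
    congr 1
    ext1 k
    rw [Measure.conv_smul_right, convPow]
  rw [h, compoundPoisson]
  ext s hs
  rw [Measure.sum_apply _ hs, Measure.add_apply, Measure.sum_apply _ hs,
    tsum_eq_zero_add' ENNReal.summable]
  simp [convPow]

theorem charFun_compoundPoisson (m : Measure E) [IsFiniteMeasure m] (z : E) :
    charFun (compoundPoisson m) z = Complex.exp (charFun m z - m.real Set.univ) := by
  have hint : Integrable (fun x : E => Complex.exp (⟪x, z⟫ * Complex.I)) (compoundPoisson m) :=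
    (integrable_const (1 : ℝ)).mono (by fun_prop) (by simp)
  have h1 := hasSum_integral_measure hint
  have h2 := NormedSpace.expSeries_div_hasSum_exp (𝔸 := ℂ) (charFun m z)
  rw [← Complex.exp_eq_exp_ℂ] at h2
  replace h2 := h2.mul_left (Complex.exp (-(m.real Set.univ : ℂ)))
  rw [charFun_apply, sub_eq_neg_add, Complex.exp_add]
  refine h1.unique ?_
  convert! h2 using 2 with k
  rw [integral_smul_measure, ← charFun_apply, charFun_convPow,
    ENNReal.toReal_ofReal (by positivity), Complex.real_smul]
  push_cast
  ring

end CompoundPoisson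

/-! ### Lévy–Khintchine exponents and existence of the corresponding laws. -/

section LevyKhintchine

variable {d : ℕ}

theorem norm_exp_I_mul_sub_one_sub_le (a : ℝ) :
    ‖Complex.exp (Complex.I * a) - 1 - Complex.I * a‖ ≤ 3 * a ^ 2 := by
  have hn : ‖Complex.I * (a : ℂ)‖ = |a| := by simp
  rcases le_total |a| 1 with h | h
  · refine (Complex.norm_exp_sub_one_sub_id_le (by rwa [hn])).trans ?_
    rw [hn, sq_abs]
    nlinarith [sq_nonneg a]
  · have h1 : ‖Complex.exp (Complex.I * a) - 1‖ ≤ |a| := Real.norm_exp_I_mul_ofReal_sub_one_le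
    calc _ ≤ ‖Complex.exp (Complex.I * a) - 1‖ + ‖Complex.I * (a : ℂ)‖ := norm_sub_le _ _
      _ ≤ |a| + |a| := by rw [hn]; gcongr
      _ ≤ 3 * |a| ^ 2 := by nlinarith
      _ = 3 * a ^ 2 := by rw [sq_abs]

/-- Quadratic for small jumps thanks to the compensator, at most 2 for large ones. The constant is
locally bounded in `z`, so the bound also serves for domination. -/
theorem norm_levyKhintchineIntegrand_le (z x : EuclideanSpace ℝ (Fin d)) :
    ‖levyKhintchineIntegrand z x‖ ≤ (3 * ‖z‖ ^ 2 + 2) * min 1 (‖x‖ ^ 2) := by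
  unfold levyKhintchineIntegrand
  by_cases hx : ‖x‖ ≤ 1
  · have h2 : ‖x‖ ^ 2 ≤ 1 := pow_le_one₀ (norm_nonneg x) hx
    rw [Set.indicator_of_mem (by exact hx), min_eq_right h2]
    refine (norm_exp_I_mul_sub_one_sub_le _).trans ?_
    have h3 : (⟪z, x⟫ : ℝ) ^ 2 ≤ ‖z‖ ^ 2 * ‖x‖ ^ 2 := by
      rw [← mul_pow, ← sq_abs]
      exact pow_le_pow_left₀ (abs_nonneg _) (abs_real_inner_le_norm z x) 2
    nlinarith [sq_nonneg ‖x‖]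
  · have h2 : 1 ≤ ‖x‖ ^ 2 := one_le_pow₀ (le_of_not_ge hx)
    rw [Set.indicator_of_notMem (by exact hx), min_eq_left h2, sub_zero]
    calc _ ≤ ‖Complex.exp (Complex.I * (⟪z, x⟫ : ℝ))‖ + ‖(1 : ℂ)‖ := norm_sub_le _ _
      _ = 2 := by rw [mul_comm, Complex.norm_exp_ofReal_mul_I]; norm_num
      _ ≤ _ := by nlinarith [sq_nonneg ‖z‖]

theorem measurable_levyKhintchineIntegrand :
    Measurable fun p : EuclideanSpace ℝ (Fin d) × EuclideanSpace ℝ (Fin d) =>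
      levyKhintchineIntegrand p.1 p.2 := by
  unfold levyKhintchineIntegrand
  refine Measurable.sub (by fun_prop) ?_
  have : (fun p : EuclideanSpace ℝ (Fin d) × EuclideanSpace ℝ (Fin d) =>
      Set.indicator {y : EuclideanSpace ℝ (Fin d) | ‖y‖ ≤ 1}
        (fun y => Complex.I * (⟪p.1, y⟫ : ℝ)) p.2)
      = Set.indicator {p : EuclideanSpace ℝ (Fin d) × EuclideanSpace ℝ (Fin d) | ‖p.2‖ ≤ 1}
        (fun p => Complex.I * (⟪p.1, p.2⟫ : ℝ)) := by
    ext p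
    simp [Set.indicator]
  rw [this]
  exact Measurable.indicator (by fun_prop) (measurableSet_le (by fun_prop) (by fun_prop))

theorem IsLevyMeasure.mono {ν ν' : Measure (EuclideanSpace ℝ (Fin d))} (hν : IsLevyMeasure ν)
    (h : ν' ≤ ν) : IsLevyMeasure ν' :=
  ⟨le_antisymm ((h _).trans hν.1.le) bot_le,
    (lintegral_mono' h le_rfl).trans_lt hν.2⟩

theorem IsLevyMeasure.integrable_min {ν : Measure (EuclideanSpace ℝ (Fin d))}
    (hν : IsLevyMeasure ν) : Integrable (fun x => min 1 (‖x‖ ^ 2)) ν := by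
  refine ⟨by fun_prop, ?_⟩
  rw [hasFiniteIntegral_iff_ofReal (ae_of_all _ fun x => by positivity)]
  exact hν.2

theorem IsLevyMeasure.integrable {ν : Measure (EuclideanSpace ℝ (Fin d))}
    (hν : IsLevyMeasure ν) (z : EuclideanSpace ℝ (Fin d)) :
    Integrable (levyKhintchineIntegrand z) ν := by
  refine (hν.integrable_min.const_mul (3 * ‖z‖ ^ 2 + 2)).mono'
    (measurable_levyKhintchineIntegrand.comp measurable_prodMk_left).aestronglyMeasurable ?_
  exact ae_of_all _ fun x => norm_levyKhintchineIntegrand_le z x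

theorem IsLevyMeasure.measure_lt_norm {ν : Measure (EuclideanSpace ℝ (Fin d))}
    (hν : IsLevyMeasure ν) {δ : ℝ} (hδ : 0 < δ) : ν {x | δ < ‖x‖} < ⊤ := by
  have h := hν.integrable_min.measure_ge_lt_top (ε := min 1 (δ ^ 2)) (by positivity)
  refine (measure_mono ?_).trans_lt h
  intro x hx
  have : δ ^ 2 ≤ ‖x‖ ^ 2 := pow_le_pow_left₀ hδ.le (le_of_lt hx) 2
  exact min_le_min le_rfl this

/-- The law with characteristic exponent `∫ (e^{i⟨z,x⟩} - 1 - i⟨z,x⟩ 1_{‖x‖ ≤ 1}) m(dx)` for a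
finite measure `m`: a shifted compound Poisson law. -/
theorem charFun_compoundPoisson_eq (m : Measure (EuclideanSpace ℝ (Fin d))) [IsFiniteMeasure m]
    (z : EuclideanSpace ℝ (Fin d)) :
    charFun (compoundPoisson m) z = Complex.exp (∫ x, levyKhintchineIntegrand z x ∂m)
      * charFun (Measure.dirac (∫ x in {x | ‖x‖ ≤ 1}, x ∂m)) z := by
  have hs : MeasurableSet {x : EuclideanSpace ℝ (Fin d) | ‖x‖ ≤ 1} :=
    measurableSet_le (by fun_prop) (by fun_prop)
  have hid : Integrable (fun x => x) (m.restrict {x : EuclideanSpace ℝ (Fin d) | ‖x‖ ≤ 1}) := by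
    refine (integrable_const (1 : ℝ)).mono' (by fun_prop) ?_
    exact (ae_restrict_iff' hs).2 (ae_of_all _ fun x hx => hx)
  have hexp : Integrable (fun x : EuclideanSpace ℝ (Fin d) =>
      Complex.exp (Complex.I * (⟪z, x⟫ : ℝ))) m := by
    refine (integrable_const (1 : ℝ)).mono' (by fun_prop) (ae_of_all _ fun x => ?_)
    rw [mul_comm, Complex.norm_exp_ofReal_mul_I]
  have hin : Integrable (fun x : EuclideanSpace ℝ (Fin d) => Complex.I * ((⟪z, x⟫ : ℝ) : ℂ))
      (m.restrict {x : EuclideanSpace ℝ (Fin d) | ‖x‖ ≤ 1}) :=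
    ((hid.const_inner z).ofReal).const_mul _
  have hchar : charFun m z = ∫ x, Complex.exp (Complex.I * (⟪z, x⟫ : ℝ)) ∂m := by
    rw [charFun_apply]
    refine integral_congr_ae (ae_of_all _ fun x => ?_)
    simp only [real_inner_comm z x, mul_comm]
  have hLK : ∫ x, levyKhintchineIntegrand z x ∂m = charFun m z - m.real Set.univ
      - Complex.I * (⟪z, ∫ x in {x | ‖x‖ ≤ 1}, x ∂m⟫ : ℝ) := by
    have hA : Integrable (fun x : EuclideanSpace ℝ (Fin d) =>
        Complex.exp (Complex.I * (⟪z, x⟫ : ℝ)) - 1) m := hexp.sub (integrable_const _)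
    unfold levyKhintchineIntegrand
    rw [integral_sub hA (by rwa [integrable_indicator_iff hs]),
      integral_sub hexp (integrable_const _), integral_indicator hs, hchar, integral_const_mul,
      integral_complex_ofReal, integral_inner hid]
    simp
  rw [charFun_compoundPoisson, hLK, charFun_dirac, ← Complex.exp_add]
  congr 1
  rw [real_inner_comm z]
  ring

theorem continuousAt_levyKhintchine_integral {ν : Measure (EuclideanSpace ℝ (Fin d))}
    (hν : IsLevyMeasure ν) :
    ContinuousAt (fun z => Complex.exp (∫ x, levyKhintchineIntegrand z x ∂ν)) 0 := by
  -- The 5 is 3‖z‖² + 2 with ‖z‖ ≤ 1.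
  refine Complex.continuous_exp.continuousAt.comp (continuousAt_of_dominated
    (bound := fun x => 5 * min 1 (‖x‖ ^ 2)) ?_ ?_ (hν.integrable_min.const_mul 5) ?_)
  · exact Filter.Eventually.of_forall fun z => (hν.integrable z).aestronglyMeasurable
  · filter_upwards [Metric.ball_mem_nhds (0 : EuclideanSpace ℝ (Fin d)) one_pos] with z hz
    refine ae_of_all _ fun x => (norm_levyKhintchineIntegrand_le z x).trans ?_
    have : ‖z‖ ^ 2 ≤ 1 := pow_le_one₀ (norm_nonneg z) (le_of_lt (by simpa using hz))
    gcongr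
    linarith
  · refine ae_of_all _ fun x => Continuous.continuousAt ?_
    unfold levyKhintchineIntegrand
    by_cases hx : ‖x‖ ≤ 1 <;> simp only [Set.indicator, Set.mem_ofPred_eq, hx, if_true, if_false] <;>
      fun_prop

/-- Existence part of the Lévy–Khintchine formula. -/
theorem IsLevyMeasure.exists_charFun_eq {ν : Measure (EuclideanSpace ℝ (Fin d))}
    (hν : IsLevyMeasure ν) :
    ∃ ρ : Measure (EuclideanSpace ℝ (Fin d)), IsProbabilityMeasure ρ ∧
      ∀ z, charFun ρ z = Complex.exp (∫ x, levyKhintchineIntegrand z x ∂ν) := by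
  let B : ℕ → Set (EuclideanSpace ℝ (Fin d)) := fun n => {x | 1 / ((n : ℝ) + 1) < ‖x‖}
  have hB : ∀ n, MeasurableSet (B n) := fun n => measurableSet_lt (by fun_prop) (by fun_prop)
  have hfin : ∀ n, IsFiniteMeasure (ν.restrict (B n)) := fun n =>
    ⟨by rw [Measure.restrict_apply_univ]; exact hν.measure_lt_norm (by positivity)⟩
  -- The Dirac shift cancels the compensator of the truncated jumps, so the exponent is exactly the
  -- integral over `B n`.
  let ρ : ℕ → Measure (EuclideanSpace ℝ (Fin d)) := fun n =>
    compoundPoisson (ν.restrict (B n)) ∗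
      Measure.dirac (-∫ x in {x | ‖x‖ ≤ 1}, x ∂(ν.restrict (B n)))
  refine exists_charFun_eq_of_tendsto (μ := ρ) (continuousAt_levyKhintchine_integral hν)
    fun z => ?_
  have hρ : ∀ n, charFun (ρ n) z
      = Complex.exp (∫ x, (B n).indicator (levyKhintchineIntegrand z) x ∂ν) := by
    intro n
    simp only [ρ]
    rw [charFun_conv, charFun_compoundPoisson_eq, mul_assoc, charFun_dirac, charFun_dirac,
      ← Complex.exp_add, integral_indicator (hB n)]
    simp [inner_neg_left]
  simp_rw [hρ]
  refine (Complex.continuous_exp.tendsto _).comp (tendsto_integral_of_dominated_convergence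
    (fun x => ‖levyKhintchineIntegrand z x‖)
    (fun n => ((hν.integrable z).indicator (hB n)).aestronglyMeasurable) (hν.integrable z).norm
    (fun n => ae_of_all _ fun x => norm_indicator_le_norm_self _ _) (ae_of_all _ fun x => ?_))
  by_cases hx : x = 0
  · have : levyKhintchineIntegrand z x = 0 := by
      simp [hx, levyKhintchineIntegrand, Set.indicator]
    simp [Set.indicator, this]
  · refine tendsto_const_nhds.congr' ?_
    filter_upwards [(tendsto_one_div_add_atTop_nhds_zero_nat (𝕜 := ℝ)).eventually
      (gt_mem_nhds (norm_pos_iff.2 hx))] with n hn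
    rw [Set.indicator_of_mem (by exact hn)]

end LevyKhintchine

/-! ### Convolutions of finite families. -/

section ConvPi

theorem absolutelyContinuous_pi {n : ℕ} {X : Type*} [MeasurableSpace X]
    (μ ν : Fin n → Measure X) [∀ i, SigmaFinite (μ i)] [∀ i, SigmaFinite (ν i)]
    (h : ∀ i, μ i ≪ ν i) : Measure.pi μ ≪ Measure.pi ν := by
  induction n with
  | zero =>
    have : Measure.pi μ = Measure.pi ν := by
      congr 1
      ext1 i
      exact i.elim0
    rw [this]
  | succ n ih =>
    have hμ := (measurePreserving_piFinSuccAbove μ 0).symm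
    have hν := (measurePreserving_piFinSuccAbove ν 0).symm
    rw [← hμ.map_eq, ← hν.map_eq]
    exact ((h 0).prod (ih _ _ fun i => h _)).map (MeasurableEquiv.measurable _)

variable {E : Type*} [NormedAddCommGroup E] [InnerProductSpace ℝ E] [FiniteDimensional ℝ E]
  [MeasurableSpace E] [BorelSpace E]

/-- The convolution of a finite family of measures. -/
noncomputable def convPi {ι : Type*} [Fintype ι] (μ : ι → Measure E) : Measure E :=
  (Measure.pi μ).map fun x => ∑ i, x i

instance isFiniteMeasure_convPi {ι : Type*} [Fintype ι] (μ : ι → Measure E)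
    [∀ i, IsFiniteMeasure (μ i)] : IsFiniteMeasure (convPi μ) := by
  unfold convPi; infer_instance

instance isProbabilityMeasure_convPi {ι : Type*} [Fintype ι] (μ : ι → Measure E)
    [∀ i, IsProbabilityMeasure (μ i)] : IsProbabilityMeasure (convPi μ) := by
  unfold convPi
  exact Measure.isProbabilityMeasure_map (by fun_prop)

theorem convPi_succ {n : ℕ} (μ : Fin (n + 1) → Measure E) [∀ i, IsFiniteMeasure (μ i)] :
    convPi μ = μ 0 ∗ convPi fun i : Fin n => μ i.succ := by
  have h := measurePreserving_piFinSuccAbove μ 0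
  have hs := h.symm
  unfold convPi Measure.conv
  rw [← hs.map_eq, Measure.map_map (by fun_prop) (MeasurableEquiv.measurable _)]
  have h2 : (μ 0).prod (Measure.map (fun x : Fin n → E => ∑ i, x i)
      (Measure.pi fun i : Fin n => μ i.succ)) = ((μ 0).prod (Measure.pi fun i : Fin n => μ i.succ)).map
        (Prod.map id fun x => ∑ i, x i) := by
    rw [← Measure.map_prod_map _ _ measurable_id (by fun_prop), Measure.map_id]
  rw [h2, Measure.map_map (by fun_prop) (by fun_prop)]
  simp only [Fin.zero_succAbove]
  congr 1
  ext1 p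
  simp [Fin.sum_univ_succ, MeasurableEquiv.piFinSuccAbove]

theorem convPi_zero (μ : Fin 0 → Measure E) : convPi μ = Measure.dirac 0 := by
  unfold convPi
  rw [Measure.pi_of_empty μ, Measure.map_dirac' (by fun_prop)]
  simp

/-- If each factor of a convolution of probability measures is `m i ∗ σ i` up to mass `ε i`, then
the whole convolution is `convPi m ∗ σ` up to mass `∑ i, ε i`. -/
theorem exists_convPi_eq_add {n : ℕ} (κ m σ : Fin n → Measure E)
    [∀ i, IsProbabilityMeasure (κ i)] [∀ i, IsFiniteMeasure (m i)] [∀ i, IsFiniteMeasure (σ i)]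
    (ε : Fin n → ENNReal) (hε : ∀ i, ε i ≠ ⊤)
    (h : ∀ i, κ i = ε i • Measure.dirac 0 + m i ∗ σ i) :
    ∃ e τ : Measure E, IsFiniteMeasure e ∧ IsFiniteMeasure τ ∧
      convPi κ = e + convPi m ∗ τ ∧ e Set.univ ≤ ∑ i, ε i := by
  induction n with
  | zero =>
    refine ⟨0, Measure.dirac 0, inferInstance, inferInstance, ?_, by simp⟩
    rw [convPi_zero, convPi_zero]
    simp
  | succ n ih =>
    obtain ⟨e, τ, he, hτ, h1, h2⟩ := ih (fun i => κ i.succ) (fun i => m i.succ)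
      (fun i => σ i.succ) (fun i => ε i.succ) (fun i => hε _) (fun i => h _)
    have hfin : IsFiniteMeasure (ε 0 • convPi fun i : Fin n => κ i.succ) := Measure.smul_finite _ (hε 0)
    have hfin' : IsFiniteMeasure (ε 0 • (Measure.dirac 0 : Measure E)) :=
      Measure.smul_finite _ (hε 0)
    -- Expand (ε₀ δ₀ + m₀ ∗ σ₀) ∗ (e + convPi m' ∗ τ), where m' is the tail of `m`; only the product
    -- of the two second terms avoids the error part.
    refine ⟨ε 0 • (convPi fun i : Fin n => κ i.succ) + (m 0 ∗ σ 0) ∗ e, σ 0 ∗ τ, inferInstance,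
      inferInstance, ?_, ?_⟩
    · have h3 : (m 0 ∗ σ 0) ∗ (convPi (fun i : Fin n => m i.succ) ∗ τ)
          = convPi m ∗ (σ 0 ∗ τ) := by
        rw [convPi_succ m, Measure.conv_assoc, Measure.conv_assoc,
          ← Measure.conv_assoc (σ 0), Measure.conv_comm (σ 0), Measure.conv_assoc]
      rw [convPi_succ κ, h 0, Measure.add_conv, Measure.conv_smul_left, Measure.dirac_zero_conv,
        ← h3, add_assoc, ← Measure.conv_add, ← h1]
    -- Being part of the probability measure `κ 0`, this factor does not enlarge the error `e`.
    · have h4 : (m 0 ∗ σ 0) Set.univ ≤ 1 := by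
        rw [← measure_univ (μ := κ 0), h 0]
        exact Measure.le_add_left le_rfl _
      rw [Fin.sum_univ_succ, Measure.add_apply, Measure.smul_apply, measure_univ, conv_univ,
        smul_eq_mul, mul_one]
      gcongr
      exact (mul_le_of_le_one_left bot_le h4).trans h2

theorem charFun_convPi {ι : Type*} [Fintype ι] (μ : ι → Measure E)
    [∀ i, IsProbabilityMeasure (μ i)] (z : E) : charFun (convPi μ) z = ∏ i, charFun (μ i) z := by
  unfold convPi
  rw [charFun_map_sum_pi_eq_prod, Finset.prod_apply]

end ConvPi

/-! ### Absolute continuity of sums of jumps in independent directions. -/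

section Cone

variable {d : ℕ}

theorem volume_preimage_linearCombination_eq_zero {w : Fin d → EuclideanSpace ℝ (Fin d)}
    (hw : LinearIndependent ℝ w) {N : Set (EuclideanSpace ℝ (Fin d))} (hN : volume N = 0) :
    volume {r : Fin d → ℝ | ∑ i, r i • w i ∈ N} = 0 := by
  let b := Module.Basis.mk hw (hw.span_eq_top_of_card_eq_finrank' (by simp)).ge
  let L : (Fin d → ℝ) ≃L[ℝ] EuclideanSpace ℝ (Fin d) := b.equivFun.symm.toContinuousLinearEquiv
  have hL : ∀ r, L r = ∑ i, r i • w i := fun r => by simp [L, b]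
  have h1 : (volume : Measure (Fin d → ℝ)).map L ≪ volume :=
    Measure.absolutelyContinuous_isAddHaarMeasure _ _
  have h2 := h1 hN
  rw [← L.coe_toHomeomorph, ← L.toHomeomorph.toMeasurableEquiv_coe, MeasurableEquiv.map_apply] at h2
  simpa [Set.preimage, hL] using h2

/-- A convolution of measures whose radial parts are absolutely continuous and whose directions
range in linearly independent sets is absolutely continuous. -/
theorem convPi_absolutelyContinuous (lam : Measure (UnitSphere d)) [IsFiniteMeasure lam]
    (U : Fin d → Set (UnitSphere d)) (hUm : ∀ i, MeasurableSet (U i))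
    (hU : ∀ w : Fin d → UnitSphere d, (∀ i, w i ∈ U i) →
      LinearIndependent ℝ (fun j => (w j : EuclideanSpace ℝ (Fin d))))
    (c : Fin d → Measure (UnitSphere d × ℝ)) [∀ i, IsFiniteMeasure (c i)]
    (hc : ∀ i, c i ≪ (lam.restrict (U i)).prod volume) :
    convPi (fun i => (c i).map fun p => p.2 • (p.1 : EuclideanSpace ℝ (Fin d))) ≪ volume := by
  unfold convPi
  rw [← Measure.pi_map_pi (fun i => by fun_prop), Measure.map_map (by fun_prop) (by fun_prop)]
  refine Measure.AbsolutelyContinuous.mk fun N hN hN0 => ?_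
  have hmeas : Measurable ((fun x : Fin d → EuclideanSpace ℝ (Fin d) => ∑ i, x i) ∘
      fun (x : Fin d → UnitSphere d × ℝ) i => (x i).2 • ((x i).1 : EuclideanSpace ℝ (Fin d))) := by
    fun_prop
  rw [Measure.map_apply hmeas hN]
  apply absolutelyContinuous_pi _ _ hc
  -- Regroup all directions before all radii: by Fubini it suffices that, for fixed independent
  -- directions, the bad radii are null.
  have hmp := (measurePreserving_arrowProdEquivProdArrow (UnitSphere d) ℝ (Fin d)
    (fun i => lam.restrict (U i)) (fun _ => volume))
  rw [← hmp.symm.map_eq, MeasurableEquiv.map_apply, ← Set.preimage_comp]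
  have hS : MeasurableSet (((fun x : Fin d → EuclideanSpace ℝ (Fin d) => ∑ i, x i) ∘
      fun (x : Fin d → UnitSphere d × ℝ) i => (x i).2 • ((x i).1 : EuclideanSpace ℝ (Fin d))) ∘
      (MeasurableEquiv.arrowProdEquivProdArrow (UnitSphere d) ℝ (Fin d)).symm ⁻¹' N) :=
    (hmeas.comp (MeasurableEquiv.measurable _)) hN
  rw [Measure.measure_prod_null hS, ← Measure.restrict_pi_pi]
  filter_upwards [ae_restrict_mem (MeasurableSet.univ_pi hUm)] with w hw
  exact volume_preimage_linearCombination_eq_zero (hU w fun i => hw i (Set.mem_univ i)) hN0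

end Cone

/-! ### The Lévy measure in polar coordinates. -/

section Polar

variable {d : ℕ}

/-- The map `(w, r) ↦ r w`. -/
noncomputable def polarMap (p : UnitSphere d × ℝ) : EuclideanSpace ℝ (Fin d) :=
  p.2 • (p.1 : EuclideanSpace ℝ (Fin d))

theorem measurable_polarMap : Measurable (polarMap (d := d)) := by
  unfold polarMap; fun_prop

theorem norm_polarMap (p : UnitSphere d × ℝ) : ‖polarMap p‖ = |p.2| := by
  simp [polarMap, norm_smul]

/-- The measure `e^{-β(w) r} / r^{α+1} lam(dw) dr` on `S^{d-1} × (0, ∞)`. -/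
noncomputable def polarMeasure (α : ℝ) (β : UnitSphere d → ℝ) (lam : Measure (UnitSphere d)) :
    Measure (UnitSphere d × ℝ) :=
  (lam.prod (volume.restrict (Set.Ioi (0 : ℝ)))).withDensity
    (fun p => ENNReal.ofReal (Real.exp (-β p.1 * p.2) / p.2 ^ (α + 1)))

theorem map_polarMeasure (α : ℝ) (β : UnitSphere d → ℝ) (lam : Measure (UnitSphere d)) :
    (polarMeasure α β lam).map polarMap = etsLevyMeasure α β lam := rfl

theorem polarMeasure_restrict_absolutelyContinuous (α : ℝ) (β : UnitSphere d → ℝ)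
    (lam : Measure (UnitSphere d)) [IsFiniteMeasure lam] (U : Set (UnitSphere d)) (t : Set ℝ) :
    (polarMeasure α β lam).restrict (U ×ˢ t) ≪ (lam.restrict U).prod volume := by
  refine ((withDensity_absolutelyContinuous _ _).restrict _).trans ?_
  rw [← Measure.prod_restrict]
  refine Measure.AbsolutelyContinuous.prod .rfl ?_
  exact (Measure.absolutelyContinuous_of_le Measure.restrict_le_self).trans
    (Measure.absolutelyContinuous_of_le Measure.restrict_le_self)

theorem polarMeasure_prod_Ioi_lt_top {α : ℝ} {β : UnitSphere d → ℝ} {lam : Measure (UnitSphere d)}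
    (hν : IsLevyMeasure (etsLevyMeasure α β lam)) (U : Set (UnitSphere d)) {δ : ℝ} (hδ : 0 < δ) :
    polarMeasure α β lam (U ×ˢ Set.Ioi δ) < ⊤ := by
  have h := hν.measure_lt_norm hδ
  rw [← map_polarMeasure, Measure.map_apply measurable_polarMap
    (measurableSet_lt (by fun_prop) (by fun_prop))] at h
  refine (measure_mono ?_).trans_lt h
  rintro p ⟨-, hp⟩
  simp only [Set.mem_preimage, Set.mem_ofPred_eq, norm_polarMap]
  exact lt_of_lt_of_le hp (le_abs_self _)

/-- On (0, 1) the exponential is at least e^{-|b|}, and r^{-(α+1)} is not integrable at 0 since α ≥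
0. -/
theorem lintegral_exp_div_rpow_eq_top {α b : ℝ} (hα : 0 ≤ α) :
    ∫⁻ r in Set.Ioi (0 : ℝ), ENNReal.ofReal (Real.exp (-b * r) / r ^ (α + 1)) = ⊤ := by
  by_contra hne
  have hint : IntegrableOn (fun r : ℝ => Real.exp (-b * r) / r ^ (α + 1)) (Set.Ioo 0 1) := by
    refine IntegrableOn.mono_set (t := Set.Ioi 0)
      ⟨Measurable.aestronglyMeasurable (by fun_prop), ?_⟩ Set.Ioo_subset_Ioi_self
    rw [hasFiniteIntegral_iff_ofReal]
    · exact lt_top_iff_ne_top.2 hne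
    · filter_upwards [ae_restrict_mem measurableSet_Ioi] with r hr
      have : (0 : ℝ) < r := hr
      simp only [Pi.zero_apply]
      positivity
  have h2 : IntegrableOn (fun r : ℝ => r ^ (-(α + 1))) (Set.Ioo 0 1) := by
    refine (hint.const_mul (Real.exp |b|)).mono' (by fun_prop) ?_
    filter_upwards [ae_restrict_mem measurableSet_Ioo] with r hr
    rw [Real.norm_of_nonneg (Real.rpow_nonneg hr.1.le _), Real.rpow_neg hr.1.le, ← mul_div_assoc,
      ← Real.exp_add, ← one_div]
    have h0 := Real.rpow_pos_of_pos hr.1 (α + 1)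
    gcongr
    rw [Real.one_le_exp_iff]
    nlinarith [le_abs_self b, abs_nonneg b, hr.1, hr.2]
  have h3 := (intervalIntegral.integrableOn_Ioo_rpow_iff (s := -(α + 1)) one_pos).1 h2
  linarith

theorem polarMeasure_prod_Ioi_zero {α : ℝ} {β : UnitSphere d → ℝ} {lam : Measure (UnitSphere d)}
    [IsFiniteMeasure lam] (hα : 0 ≤ α) (hβ : Measurable β) {U : Set (UnitSphere d)}
    (hUm : MeasurableSet U) (hU : 0 < lam U) :
    polarMeasure α β lam (U ×ˢ Set.Ioi 0) = ⊤ := by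
  rw [polarMeasure, withDensity_apply _ (hUm.prod measurableSet_Ioi), ← Measure.prod_restrict,
    Measure.restrict_restrict measurableSet_Ioi, Set.inter_self, lintegral_prod _ (by fun_prop)]
  simp only [lintegral_exp_div_rpow_eq_top hα]
  rw [lintegral_const, Measure.restrict_apply_univ, ENNReal.top_mul hU.ne']

theorem tendsto_polarMeasure_prod_Ioi {α : ℝ} {β : UnitSphere d → ℝ}
    {lam : Measure (UnitSphere d)} [IsFiniteMeasure lam] (hα : 0 ≤ α) (hβ : Measurable β)
    {U : Set (UnitSphere d)} (hUm : MeasurableSet U) (hU : 0 < lam U) :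
    Filter.Tendsto (fun n : ℕ => polarMeasure α β lam (U ×ˢ Set.Ioi (1 / ((n : ℝ) + 1))))
      Filter.atTop (nhds ⊤) := by
  rw [← polarMeasure_prod_Ioi_zero hα hβ hUm hU]
  have hun : U ×ˢ Set.Ioi (0 : ℝ) = ⋃ n : ℕ, U ×ˢ Set.Ioi (1 / ((n : ℝ) + 1)) := by
    ext p
    simp only [Set.mem_prod, Set.mem_Ioi, Set.mem_iUnion, exists_and_left]
    refine and_congr_right fun _ => ⟨fun h => exists_nat_one_div_lt h, fun ⟨n, hn⟩ => ?_⟩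
    exact lt_trans (by positivity) hn
  rw [hun]
  refine tendsto_measure_iUnion_atTop fun m n hmn => ?_
  refine Set.prod_mono_right (Set.Ioi_subset_Ioi ?_)
  exact Nat.one_div_le_one_div hmn

/-- Linear independence is an open condition, so it holds on a product neighbourhood. Disjointness
is then automatic: a common point could be used as two of the vectors at once. -/
theorem exists_open_linearIndependent {w : Fin d → UnitSphere d}
    (hw : LinearIndependent ℝ (fun j => (w j : EuclideanSpace ℝ (Fin d)))) :
    ∃ U : Fin d → Set (UnitSphere d), (∀ i, IsOpen (U i) ∧ w i ∈ U i) ∧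
      (∀ u : Fin d → UnitSphere d, (∀ i, u i ∈ U i) →
        LinearIndependent ℝ (fun j => (u j : EuclideanSpace ℝ (Fin d)))) ∧
      Pairwise (Function.onFun Disjoint U) := by
  have hopen : IsOpen {u : Fin d → UnitSphere d |
      LinearIndependent ℝ (fun j => (u j : EuclideanSpace ℝ (Fin d)))} :=
    (isOpen_setOfPred_linearIndependent (𝕜 := ℝ) (E := EuclideanSpace ℝ (Fin d))
      (ι := Fin d)).preimage (f := fun (u : Fin d → UnitSphere d) (j : Fin d) =>
        (u j : EuclideanSpace ℝ (Fin d))) (by fun_prop)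
  obtain ⟨U, hU, hsub⟩ := isOpen_pi_iff'.1 hopen w hw
  have hli : ∀ u : Fin d → UnitSphere d, (∀ i, u i ∈ U i) →
      LinearIndependent ℝ (fun j => (u j : EuclideanSpace ℝ (Fin d))) :=
    fun u hu => hsub fun i _ => hu i
  refine ⟨U, hU, hli, fun i j hij => Set.disjoint_left.2 fun v hvi hvj => hij ?_⟩
  have h := hli (fun k => if k = i ∨ k = j then v else w k) fun k => by
    by_cases hk : k = i ∨ k = j
    · rw [if_pos hk]
      rcases hk with rfl | rfl <;> assumption
    · rw [if_neg hk]
      exact (hU k).2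
  exact h.injective (by simp)

end Polar

/-! ### Spanning support implies absolute continuity. -/

section AbsolutelyContinuous

variable {d : ℕ}

theorem etsLevyMeasure_eq_add (α : ℝ) (β : UnitSphere d → ℝ) (lam : Measure (UnitSphere d))
    {C : Fin d → Set (UnitSphere d × ℝ)} (hC : ∀ i, MeasurableSet (C i))
    (hd : Pairwise (Function.onFun Disjoint C)) :
    etsLevyMeasure α β lam = ∑ i, ((polarMeasure α β lam).restrict (C i)).map polarMap
      + ((polarMeasure α β lam).restrict (⋃ i, C i)ᶜ).map polarMap := by
  conv_lhs => rw [← map_polarMeasure,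
    ← Measure.restrict_add_restrict_compl (μ := polarMeasure α β lam) (MeasurableSet.iUnion hC),
    Measure.map_add _ _ measurable_polarMap, Measure.restrict_iUnion hd hC,
    Measure.map_sum measurable_polarMap.aemeasurable, Measure.sum_fintype]

/-- The part of an ETαS law carried by the jumps with polar coordinates in `⋃ i, C i` splits off
as a convolution of compound Poisson laws. -/
theorem IsExpTemperedStable.exists_eq_convPi_conv {α : ℝ} {β : UnitSphere d → ℝ}
    {lam : Measure (UnitSphere d)} {μ : Measure (EuclideanSpace ℝ (Fin d))}
    (hμ : IsExpTemperedStable α β lam μ)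
    {C : Fin d → Set (UnitSphere d × ℝ)} (hC : ∀ i, MeasurableSet (C i))
    (hd : Pairwise (Function.onFun Disjoint C))
    [hfin : ∀ i, IsFiniteMeasure ((polarMeasure α β lam).restrict (C i))] :
    ∃ ρ : Measure (EuclideanSpace ℝ (Fin d)), IsProbabilityMeasure ρ ∧
      μ = convPi (fun i => compoundPoisson
        (((polarMeasure α β lam).restrict (C i)).map polarMap)) ∗ ρ := by
  obtain ⟨γ, hγ⟩ := hμ.hasLevyTriplet
  have hprob := hγ.isProbabilityMeasure
  set m : Fin d → Measure (EuclideanSpace ℝ (Fin d)) :=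
    fun i => ((polarMeasure α β lam).restrict (C i)).map polarMap with hm
  set ν' := ((polarMeasure α β lam).restrict (⋃ i, C i)ᶜ).map polarMap with hν'
  have hsum : etsLevyMeasure α β lam = ∑ i, m i + ν' := etsLevyMeasure_eq_add α β lam hC hd
  have hle : ν' ≤ etsLevyMeasure α β lam := by
    rw [hsum]
    exact Measure.le_add_left le_rfl
  have hle' : ∀ i, m i ≤ etsLevyMeasure α β lam := fun i => by
    rw [← map_polarMeasure]
    exact Measure.map_mono Measure.restrict_le_self measurable_polarMap
  obtain ⟨ρ, hρ, hρc⟩ := (hγ.isLevyMeasure.mono hle).exists_charFun_eq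
  -- The remaining jumps, with the drift corrected by the compensators absent from the uncompensated
  -- compound Poisson factors.
  refine ⟨ρ ∗ Measure.dirac (γ - ∑ i, ∫ x in {x | ‖x‖ ≤ 1}, x ∂(m i)), inferInstance, ?_⟩
  refine Measure.ext_of_charFun ?_
  ext1 z
  rw [hγ.charFun_eq, charFun_conv, charFun_conv, charFun_convPi, hρc]
  simp_rw [charFun_compoundPoisson_eq, charFun_dirac]
  rw [Finset.prod_mul_distrib, ← Complex.exp_sum, ← Complex.exp_sum, ← Complex.exp_add,
    ← Complex.exp_add, ← Complex.exp_add, hsum, integral_add_measure,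
    integral_finsetSum_measure fun i _ => (hγ.isLevyMeasure.mono (hle' i)).integrable z]
  · congr 1
    rw [inner_sub_left, sum_inner]
    push_cast
    rw [sub_mul, Finset.sum_mul]
    simp
    ring
  · rw [integrable_finsetSum_measure]
    exact fun i _ => (hγ.isLevyMeasure.mono (hle' i)).integrable z
  · exact (hγ.isLevyMeasure.mono hle).integrable z

theorem IsExpTemperedStable.absolutelyContinuous {α : ℝ} {β : UnitSphere d → ℝ}
    {lam : Measure (UnitSphere d)} {μ : Measure (EuclideanSpace ℝ (Fin d))}
    (hμ : IsExpTemperedStable α β lam μ) {w : Fin d → UnitSphere d}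
    (hw : ∀ j, w j ∈ lam.support)
    (hli : LinearIndependent ℝ (fun j => (w j : EuclideanSpace ℝ (Fin d)))) : μ ≪ volume := by
  have hlam := hμ.isFiniteMeasure
  have hlevy : IsLevyMeasure (etsLevyMeasure α β lam) := by
    obtain ⟨γ, hγ⟩ := hμ.hasLevyTriplet
    exact hγ.isLevyMeasure
  obtain ⟨U, hU, hUli, hUd⟩ := exists_open_linearIndependent hli
  have hUm : ∀ i, MeasurableSet (U i) := fun i => (hU i).1.measurableSet
  have hUpos : ∀ i, 0 < lam (U i) := fun i =>
    Measure.mem_support_iff_forall _ |>.1 (hw i) _ ((hU i).1.mem_nhds (hU i).2)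
  let C : ℕ → Fin d → Set (UnitSphere d × ℝ) := fun n i => U i ×ˢ Set.Ioi (1 / ((n : ℝ) + 1))
  have hCm : ∀ n i, MeasurableSet (C n i) := fun n i => (hUm i).prod measurableSet_Ioi
  have hCd : ∀ n, Pairwise (Function.onFun Disjoint (C n)) := fun n i j hij =>
    Set.disjoint_prod.2 (Or.inl (hUd hij))
  have hCfin : ∀ n i, polarMeasure α β lam (C n i) < ⊤ := fun n i =>
    polarMeasure_prod_Ioi_lt_top hlevy _ (by positivity)
  have hfin : ∀ n i, IsFiniteMeasure ((polarMeasure α β lam).restrict (C n i)) := fun n i =>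
    ⟨by rw [Measure.restrict_apply_univ]; exact hCfin n i⟩
  let m : ℕ → Fin d → Measure (EuclideanSpace ℝ (Fin d)) :=
    fun n i => ((polarMeasure α β lam).restrict (C n i)).map polarMap
  have hmass : ∀ n i, (m n i).real Set.univ = (polarMeasure α β lam (C n i)).toReal := fun n i => by
    simp only [m]
    rw [Measure.real, Measure.map_apply measurable_polarMap MeasurableSet.univ, Set.preimage_univ,
      Measure.restrict_apply_univ]
  refine Measure.AbsolutelyContinuous.mk fun N hN hN0 => ?_
  -- Up to the error `e`, `μ` has the absolutely continuous factor `convPi (m n)`, so only `e ∗ ρ`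
  -- can charge `N`.
  have hbound : ∀ n, μ N ≤ ∑ i, ENNReal.ofReal
      (Real.exp (-(polarMeasure α β lam (C n i)).toReal)) := by
    intro n
    obtain ⟨ρ, hρ, hμρ⟩ := hμ.exists_eq_convPi_conv (hCm n) (hCd n)
    obtain ⟨e, τ, he, hτ, h1, h2⟩ := exists_convPi_eq_add (fun i => compoundPoisson (m n i)) (m n)
      (fun i => compoundPoissonTail (m n i)) _ (fun i => ENNReal.ofReal_ne_top)
      (fun i => compoundPoisson_eq_add (m n i))
    simp_rw [hmass] at h2
    have hac : convPi (m n) ≪ volume := convPi_absolutelyContinuous lam U hUm hUli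
      (fun i => (polarMeasure α β lam).restrict (C n i))
      fun i => polarMeasure_restrict_absolutelyContinuous α β lam _ _
    have h0 : ((convPi (m n) ∗ τ) ∗ ρ) N = 0 := by
      have : (convPi (m n) ∗ τ) ∗ ρ ≪ volume := by
        rw [Measure.conv_assoc, Measure.conv_comm]
        exact Measure.conv_absolutelyContinuous hac
      exact this hN0
    calc μ N = (e ∗ ρ) N + ((convPi (m n) ∗ τ) ∗ ρ) N := by
          rw [hμρ, h1, Measure.add_conv, Measure.add_apply]
      _ ≤ (e ∗ ρ) Set.univ := by
          rw [h0, add_zero]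
          exact measure_mono (Set.subset_univ _)
      _ = e Set.univ := by rw [conv_univ, measure_univ (μ := ρ), mul_one]
      _ ≤ _ := h2
  have hlim : Filter.Tendsto (fun n => ∑ i, ENNReal.ofReal
      (Real.exp (-(polarMeasure α β lam (C n i)).toReal))) Filter.atTop (nhds 0) := by
    have h0 : ∑ _i : Fin d, (0 : ENNReal) = 0 := Finset.sum_const_zero
    refine h0 ▸ tendsto_finsetSum _ fun i _ => ?_
    rw [← ENNReal.ofReal_zero]
    refine ENNReal.tendsto_ofReal (Real.tendsto_exp_neg_atTop_nhds_zero.comp ?_)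
    refine Filter.tendsto_atTop.2 fun b => ?_
    filter_upwards [ENNReal.tendsto_nhds_top_iff_nnreal.1 (tendsto_polarMeasure_prod_Ioi
      hμ.alpha_mem.1 hμ.measurable_beta (hUm i) (hUpos i)) b.toNNReal] with n hn
    exact (ENNReal.ofReal_le_iff_le_toReal (hCfin n i).ne).1 hn.le
  exact le_antisymm (ge_of_tendsto' hlim hbound) bot_le

end AbsolutelyContinuous

/-! ### Absolute continuity implies spanning support. -/

section Degenerate

variable {d : ℕ}

/-- Transfers a property of whole rays from λ to the Lévy measure; only absolute continuity of the
polar measure matters. -/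
theorem ae_etsLevyMeasure {α : ℝ} {β : UnitSphere d → ℝ} {lam : Measure (UnitSphere d)}
    [IsFiniteMeasure lam] {Q : EuclideanSpace ℝ (Fin d) → Prop} (hQ : MeasurableSet {x | Q x})
    (h : ∀ᵐ (w : UnitSphere d) ∂lam, ∀ r : ℝ, Q (r • (w : EuclideanSpace ℝ (Fin d)))) :
    ∀ᵐ x ∂etsLevyMeasure α β lam, Q x := by
  rw [← map_polarMeasure, ae_map_iff measurable_polarMap.aemeasurable hQ]
  refine (withDensity_absolutelyContinuous _ _).ae_le ?_
  filter_upwards [Measure.quasiMeasurePreserving_fst.ae h] with p hp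
  exact hp p.2

theorem exists_linearIndependent_of_span_eq_top {s : Set (UnitSphere d)}
    (hs : Submodule.span ℝ (Subtype.val '' s) = (⊤ : Submodule ℝ (EuclideanSpace ℝ (Fin d)))) :
    ∃ w : Fin d → UnitSphere d, (∀ j, w j ∈ s) ∧
      LinearIndependent ℝ (fun j => (w j : EuclideanSpace ℝ (Fin d))) := by
  obtain ⟨b, hb, hspan, hli⟩ := exists_linearIndependent ℝ
    (Subtype.val '' s : Set (EuclideanSpace ℝ (Fin d)))
  let B := Module.Basis.mk hli (by rw [Subtype.range_coe, hspan, hs])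
  -- Comparison with the standard basis reindexes the extracted basis by `Fin d`.
  let e := B.indexEquiv (EuclideanSpace.basisFun (Fin d) ℝ).toBasis
  choose w hw using fun j => hb (e.symm j).2
  refine ⟨w, fun j => (hw j).1, ?_⟩
  have : (fun j => (w j : EuclideanSpace ℝ (Fin d))) = (fun x : b => (x : EuclideanSpace ℝ (Fin d))) ∘ e.symm :=
    funext fun j => (hw j).2
  rw [this]
  exact hli.comp _ e.symm.injective

theorem volume_inner_eq_eq_zero {z : EuclideanSpace ℝ (Fin d)} (hz : z ≠ 0)
    (γ : EuclideanSpace ℝ (Fin d)) :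
    volume {x : EuclideanSpace ℝ (Fin d) | (⟪z, x⟫ : ℝ) = ⟪z, γ⟫} = 0 := by
  have hne : (Submodule.span ℝ {z})ᗮ ≠ ⊤ := by
    intro h
    have : z ∈ (Submodule.span ℝ {z})ᗮ := h ▸ Submodule.mem_top
    rw [Submodule.mem_orthogonal_singleton_iff_inner_right] at this
    exact hz (inner_self_eq_zero.1 this)
  have h0 := Measure.addHaar_submodule volume _ hne
  rw [← measure_preimage_add_right volume (-γ)] at h0
  convert h0 using 2
  ext x
  simp only [Set.mem_ofPred_eq, Set.mem_preimage, SetLike.mem_coe,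
    Submodule.mem_orthogonal_singleton_iff_inner_right, ← sub_eq_add_neg, inner_sub_right,
    sub_eq_zero]

theorem IsExpTemperedStable.span_support_eq_top {α : ℝ} {β : UnitSphere d → ℝ}
    {lam : Measure (UnitSphere d)} {μ : Measure (EuclideanSpace ℝ (Fin d))}
    (hμ : IsExpTemperedStable α β lam μ) (hac : μ ≪ volume) :
    Submodule.span ℝ (Subtype.val '' lam.support)
      = (⊤ : Submodule ℝ (EuclideanSpace ℝ (Fin d))) := by
  have hlam := hμ.isFiniteMeasure
  obtain ⟨γ, hγ⟩ := hμ.hasLevyTriplet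
  have hprob := hγ.isProbabilityMeasure
  by_contra hne
  rw [← Submodule.orthogonal_eq_bot_iff, Submodule.eq_bot_iff] at hne
  push Not at hne
  obtain ⟨z, hzV, hz⟩ := hne
  have hν : ∀ᵐ x ∂etsLevyMeasure α β lam, (⟪z, x⟫ : ℝ) = 0 := by
    refine ae_etsLevyMeasure (measurableSet_eq_fun (by fun_prop) (by fun_prop)) ?_
    filter_upwards [Measure.support_mem_ae] with w hw r
    rw [inner_smul_right, (Submodule.mem_orthogonal' _ _).1 hzV _
      (Submodule.subset_span ⟨w, hw, rfl⟩), mul_zero]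
  -- No jump has a component along `z`, so only the drift survives on the line ℝz.
  have hchar : ∀ t : ℝ, charFun μ (t • z) = Complex.exp (Complex.I * (⟪γ, t • z⟫ : ℝ)) := by
    intro t
    have h0 : ∫ x, levyKhintchineIntegrand (t • z) x ∂etsLevyMeasure α β lam = 0 := by
      refine integral_eq_zero_of_ae ?_
      filter_upwards [hν] with x hx
      have hx' : (⟪t • z, x⟫ : ℝ) = 0 := by rw [real_inner_smul_left, hx, mul_zero]
      simp [levyKhintchineIntegrand, Set.indicator, hx, inner_smul_left]
    rw [hγ.charFun_eq, h0]
    simp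
  have hmap : μ.map (fun x => (⟪z, x⟫ : ℝ)) = Measure.dirac ⟪z, γ⟫ := by
    have : IsProbabilityMeasure (μ.map fun x => (⟪z, x⟫ : ℝ)) :=
      Measure.isProbabilityMeasure_map (by fun_prop)
    refine Measure.ext_of_charFun ?_
    ext1 t
    have h1 : charFun (μ.map fun x => (⟪z, x⟫ : ℝ)) t = charFun μ (t • z) := by
      rw [charFun_apply, integral_map (by fun_prop) (by fun_prop), charFun_apply]
      simp [inner_smul_right, real_inner_comm z, mul_comm]
    rw [h1, hchar, charFun_dirac, inner_smul_right, real_inner_comm γ z, mul_comm Complex.I]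
    simp
  have h1 : μ {x | (⟪z, x⟫ : ℝ) = ⟪z, γ⟫} = 1 := by
    have : {x : EuclideanSpace ℝ (Fin d) | (⟪z, x⟫ : ℝ) = ⟪z, γ⟫}
        = (fun x => (⟪z, x⟫ : ℝ)) ⁻¹' {⟪z, γ⟫} := rfl
    rw [this, ← Measure.map_apply (by fun_prop) (measurableSet_singleton _), hmap]
    simp
  rw [hac (volume_inner_eq_eq_zero hz γ)] at h1
  exact zero_ne_one h1

end Degenerate

/-! ### Independence of the components. -/

section Independence

variable {d : ℕ}

/-- The marginal characteristic functions are the restrictions of that of μ to the axes, so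
independence depends on μ alone. -/
theorem iIndepFun_iff_charFun_single {μ : Measure (EuclideanSpace ℝ (Fin d))} {Ω : Type*}
    [MeasurableSpace Ω] {P : Measure Ω} [IsProbabilityMeasure P]
    {X : Ω → EuclideanSpace ℝ (Fin d)} (hX : HasLaw X μ P) :
    iIndepFun (fun i ω => X ω i) P ↔
      ∀ t, charFun μ t = ∏ i, charFun μ (EuclideanSpace.single i (t i)) := by
  have hXm := hX.aemeasurable
  have hXi : ∀ i, AEMeasurable (fun ω => X ω i) P := fun i =>
    (by fun_prop : Measurable fun x : EuclideanSpace ℝ (Fin d) => x i).comp_aemeasurable hXm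
  rw [iIndepFun_iff_charFun_pi hXi]
  refine forall_congr' fun t => ?_
  have h1 : (fun ω => WithLp.toLp 2 (fun i => X ω i)) = X := rfl
  have h2 : ∀ i, charFun (P.map fun ω => X ω i) (t i)
      = charFun μ (EuclideanSpace.single i (t i)) := by
    intro i
    have : P.map (fun ω => X ω i) = μ.map fun x => x i := by
      rw [← hX.map_eq, AEMeasurable.map_map_of_aemeasurable (by fun_prop) hXm]
      rfl
    rw [this, charFun_apply, charFun_apply, integral_map (by fun_prop) (by fun_prop)]
    simp [EuclideanSpace.inner_single_right]
  rw [h1, hX.map_eq]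
  simp_rw [h2]

theorem levyKhintchineIntegrand_of_inner_eq_zero {z x : EuclideanSpace ℝ (Fin d)}
    (h : (⟪z, x⟫ : ℝ) = 0) : levyKhintchineIntegrand z x = 0 := by
  simp [levyKhintchineIntegrand, Set.indicator, h]

theorem levyKhintchineIntegrand_single (t : EuclideanSpace ℝ (Fin d)) (j : Fin d) (s : ℝ) :
    levyKhintchineIntegrand t (EuclideanSpace.single j s)
      = ∑ i, levyKhintchineIntegrand (EuclideanSpace.single i (t i))
        (EuclideanSpace.single j s) := by
  rw [Finset.sum_eq_single j]
  · simp [levyKhintchineIntegrand, EuclideanSpace.inner_single_right, Set.indicator]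
  · intro i _ hij
    apply levyKhintchineIntegrand_of_inner_eq_zero
    simp [EuclideanSpace.inner_single_right, hij.symm]
  · simp

/-- The compensator is purely imaginary, so the truncation disappears. -/
theorem re_levyKhintchineIntegrand (z x : EuclideanSpace ℝ (Fin d)) :
    (levyKhintchineIntegrand z x).re = Real.cos ⟪z, x⟫ - 1 := by
  have h : (Complex.exp (Complex.I * (⟪z, x⟫ : ℝ))).re = Real.cos ⟪z, x⟫ := by
    rw [mul_comm, Complex.exp_ofReal_mul_I_re]
  by_cases hx : ‖x‖ ≤ 1 <;> simp [levyKhintchineIntegrand, Set.indicator, hx, h]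

variable {α : ℝ} {β : UnitSphere d → ℝ} {lam : Measure (UnitSphere d)}
  {μ : Measure (EuclideanSpace ℝ (Fin d))}

theorem IsExpTemperedStable.charFun_eq_prod_of_support (hμ : IsExpTemperedStable α β lam μ)
    (h : ∀ w ∈ lam.support, ∃ i : Fin d,
          (w : EuclideanSpace ℝ (Fin d)) = EuclideanSpace.single i 1 ∨
          (w : EuclideanSpace ℝ (Fin d)) = -EuclideanSpace.single i 1)
    (t : EuclideanSpace ℝ (Fin d)) :
    charFun μ t = ∏ i, charFun μ (EuclideanSpace.single i (t i)) := by
  have hlam := hμ.isFiniteMeasure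
  obtain ⟨γ, hγ⟩ := hμ.hasLevyTriplet
  have hae : ∀ᵐ x ∂etsLevyMeasure α β lam, levyKhintchineIntegrand t x
      = ∑ i, levyKhintchineIntegrand (EuclideanSpace.single i (t i)) x := by
    have hm : ∀ z : EuclideanSpace ℝ (Fin d), Measurable (levyKhintchineIntegrand z) := by
      intro z
      have := measurable_levyKhintchineIntegrand.comp (measurable_prodMk_left (x := z))
      exact this
    have hms : MeasurableSet {x : EuclideanSpace ℝ (Fin d) | levyKhintchineIntegrand t x
        = ∑ i, levyKhintchineIntegrand (EuclideanSpace.single i (t i)) x} :=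
      measurableSet_eq_fun (hm t)
        (Finset.measurable_fun_sum Finset.univ fun i _ => hm (EuclideanSpace.single i (t i)))
    refine ae_etsLevyMeasure hms ?_
    filter_upwards [Measure.support_mem_ae] with w hw r
    obtain ⟨j, hj | hj⟩ := h w hw
    · have : r • (w : EuclideanSpace ℝ (Fin d)) = EuclideanSpace.single j r := by
        rw [hj]
        ext k
        by_cases hk : k = j <;> simp [hk]
      rw [this, levyKhintchineIntegrand_single]
    · have : r • (w : EuclideanSpace ℝ (Fin d)) = EuclideanSpace.single j (-r) := by
        rw [hj]
        ext k
        by_cases hk : k = j <;> simp [hk]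
      rw [this, levyKhintchineIntegrand_single]
  simp_rw [hγ.charFun_eq]
  rw [← Complex.exp_sum, integral_congr_ae hae,
    integral_finsetSum _ fun i _ => hγ.isLevyMeasure.integrable _, Finset.sum_add_distrib]
  congr 2
  simp only [Matrix.zero_apply, mul_zero, zero_mul, Finset.sum_const_zero, Complex.ofReal_zero,
    sub_zero]
  rw [← Finset.mul_sum, ← Complex.ofReal_sum]
  congr 2
  rw [PiLp.inner_apply]
  simp [EuclideanSpace.inner_single_right]

theorem IsExpTemperedStable.ae_cos_mul_cos_eq_zero (hμ : IsExpTemperedStable α β lam μ)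
    (h : ∀ t, charFun μ t = ∏ i, charFun μ (EuclideanSpace.single i (t i)))
    {i j : Fin d} (hij : i ≠ j) :
    ∀ᵐ x ∂etsLevyMeasure α β lam, (1 - Real.cos (x i)) * (1 - Real.cos (x j)) = 0 := by
  obtain ⟨γ, hγ⟩ := hμ.hasLevyTriplet
  have hint : ∀ z, Integrable (fun x => Real.cos ⟪z, x⟫ - 1) (etsLevyMeasure α β lam) := by
    intro z
    simp_rw [← re_levyKhintchineIntegrand]
    exact (hγ.isLevyMeasure.integrable z).re
  let f : EuclideanSpace ℝ (Fin d) → EuclideanSpace ℝ (Fin d) → ℝ :=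
    fun z x => Real.cos ⟪z, x⟫ - 1
  have hf : ∀ z, Integrable (f z) (etsLevyMeasure α β lam) := hint
  set R : EuclideanSpace ℝ (Fin d) → ℝ :=
    fun z => ∫ x, (Real.cos ⟪z, x⟫ - 1) ∂etsLevyMeasure α β lam with hR
  -- Passing to the modulus removes the drift and the compensator.
  have hnorm : ∀ z, ‖charFun μ z‖ = Real.exp (R z) := by
    intro z
    have : R z = (∫ x, levyKhintchineIntegrand z x ∂etsLevyMeasure α β lam).re := by
      simp_rw [hR, ← re_levyKhintchineIntegrand]
      exact integral_re (hγ.isLevyMeasure.integrable z)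
    rw [hγ.charFun_eq, Complex.norm_exp, this]
    simp
  have hadd : ∀ t, R t = ∑ k, R (EuclideanSpace.single k (t k)) := by
    intro t
    apply Real.exp_injective
    rw [Real.exp_sum, ← hnorm, h t, norm_prod]
    simp_rw [hnorm]
  have hR0 : R 0 = 0 := by simp [hR]
  have hpair : ∀ b : ℝ, R (EuclideanSpace.single i 1 + EuclideanSpace.single j b)
      = R (EuclideanSpace.single i 1) + R (EuclideanSpace.single j b) := by
    intro b
    rw [hadd, Finset.sum_eq_add_of_mem i j (Finset.mem_univ _) (Finset.mem_univ _) hij]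
    · simp [hij, hij.symm]
    · rintro k - ⟨hki, hkj⟩
      have h0 : EuclideanSpace.single k (0 : ℝ) = 0 := by ext; simp
      simp [hki, hkj, h0, hR0]
  have h1 := hpair 1
  have h2 := hpair (-1)
  -- This uses cos(a + b) + cos(a - b) = 2 cos a cos b. The four groups are those whose integrals
  -- `h1` and `h2` compare.
  have hcos : (fun x : EuclideanSpace ℝ (Fin d) =>
        2 * ((1 - Real.cos (x i)) * (1 - Real.cos (x j))))
      = f (EuclideanSpace.single i 1 + EuclideanSpace.single j 1)
        + f (EuclideanSpace.single i 1 + EuclideanSpace.single j (-1))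
        - (f (EuclideanSpace.single i 1) + f (EuclideanSpace.single j 1))
        - (f (EuclideanSpace.single i 1) + f (EuclideanSpace.single j (-1))) := by
    ext1 x
    simp only [f, Pi.add_apply, Pi.sub_apply, inner_add_left, EuclideanSpace.inner_single_left,
      map_one, one_mul, map_neg, neg_mul, Real.cos_add, Real.cos_neg, Real.sin_neg]
    ring
  have hzero : ∫ x, 2 * ((1 - Real.cos (x i)) * (1 - Real.cos (x j))) ∂etsLevyMeasure α β lam
      = 0 := by
    rw [hcos, integral_sub' (((hf _).add (hf _)).sub ((hf _).add (hf _)))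
        ((hf _).add (hf _)),
      integral_sub' ((hf _).add (hf _)) ((hf _).add (hf _)),
      integral_add' (hf _) (hf _), integral_add' (hf _) (hf _), integral_add' (hf _) (hf _)]
    simp only [hR] at h1 h2
    simp only [f]
    linarith
  have hint2 : Integrable (fun x : EuclideanSpace ℝ (Fin d) =>
      2 * ((1 - Real.cos (x i)) * (1 - Real.cos (x j)))) (etsLevyMeasure α β lam) := by
    rw [hcos]
    exact (((hf _).add (hf _)).sub ((hf _).add (hf _))).sub ((hf _).add (hf _))
  rw [integral_eq_zero_iff_of_nonneg_ae (ae_of_all _ fun x => ?_) hint2] at hzero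
  · filter_upwards [hzero] with x hx
    exact (mul_eq_zero.1 hx).resolve_left two_ne_zero
  · exact mul_nonneg zero_le_two
      (mul_nonneg (by simp [Real.cos_le_one]) (by simp [Real.cos_le_one]))

theorem IsExpTemperedStable.ae_mul_eq_zero (hμ : IsExpTemperedStable α β lam μ)
    (h : ∀ t, charFun μ t = ∏ i, charFun μ (EuclideanSpace.single i (t i)))
    {i j : Fin d} (hij : i ≠ j) :
    ∀ᵐ (w : UnitSphere d) ∂lam, (w : EuclideanSpace ℝ (Fin d)) i * (w : EuclideanSpace ℝ (Fin d)) j = 0 := by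
  have hlam := hμ.isFiniteMeasure
  have hβ := hμ.measurable_beta
  have h1 := hμ.ae_cos_mul_cos_eq_zero h hij
  rw [← map_polarMeasure] at h1
  have h2 := ae_of_ae_map measurable_polarMap.aemeasurable h1
  -- The density is positive on r > 0, so null sets pass back to the product measure.
  have hac : lam.prod (volume.restrict (Set.Ioi (0 : ℝ))) ≪ polarMeasure α β lam := by
    refine withDensity_absolutelyContinuous' (by fun_prop) ?_
    have hpos : ∀ᵐ p ∂lam.prod (volume.restrict (Set.Ioi (0 : ℝ))), p.2 ∈ Set.Ioi (0 : ℝ) :=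
      Measure.quasiMeasurePreserving_snd.ae (ae_restrict_mem measurableSet_Ioi)
    filter_upwards [hpos] with p hp
    have : (0 : ℝ) < p.2 := hp
    exact (ENNReal.ofReal_pos.2 (by positivity)).ne'
  filter_upwards [Measure.ae_ae_of_ae_prod (hac.ae_le h2)] with w hw
  have hw' := (ae_restrict_iff' measurableSet_Ioi).1 hw
  have hne : (ae (volume.restrict (Set.Ioo (0 : ℝ) 1))).NeBot := by
    rw [ae_neBot, Ne, Measure.restrict_eq_zero]
    simp
  -- A single good radius r < 1 suffices: then |r w_k| < 2π, and the cosine equals 1 only at 0.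
  obtain ⟨r, hr, hr01⟩ := ((ae_restrict_of_ae (s := Set.Ioo (0 : ℝ) 1) hw').and
    (ae_restrict_mem measurableSet_Ioo)).exists
  have hr2 := hr hr01.1
  have hcos : ∀ k : Fin d, 1 - Real.cos (polarMap (w, r) k) = 0 →
      (w : EuclideanSpace ℝ (Fin d)) k = 0 := by
    intro k hk
    have hk' : Real.cos (r * (w : EuclideanSpace ℝ (Fin d)) k) = 1 := by
      have : Real.cos (polarMap (w, r) k) = 1 := by linarith
      simpa [polarMap] using this
    have hwk : |(w : EuclideanSpace ℝ (Fin d)) k| ≤ 1 := by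
      have := PiLp.norm_apply_le (w : EuclideanSpace ℝ (Fin d)) k
      rwa [norm_eq_of_mem_sphere, Real.norm_eq_abs] at this
    have hlt : |r * (w : EuclideanSpace ℝ (Fin d)) k| < 2 * Real.pi := by
      rw [abs_mul, abs_of_pos hr01.1]
      nlinarith [Real.pi_gt_three, abs_nonneg ((w : EuclideanSpace ℝ (Fin d)) k), hr01.1, hr01.2]
    rw [Real.cos_eq_one_iff_of_lt_of_lt (abs_lt.1 hlt).1 (abs_lt.1 hlt).2] at hk'
    exact (mul_eq_zero.1 hk').resolve_left hr01.1.ne'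
  rcases mul_eq_zero.1 hr2 with h3 | h3
  · rw [hcos i h3, zero_mul]
  · rw [hcos j h3, mul_zero]

theorem eq_single_of_mul_eq_zero (w : UnitSphere d)
    (h : ∀ i j, i ≠ j → (w : EuclideanSpace ℝ (Fin d)) i * (w : EuclideanSpace ℝ (Fin d)) j = 0) :
    ∃ i : Fin d, (w : EuclideanSpace ℝ (Fin d)) = EuclideanSpace.single i 1 ∨
      (w : EuclideanSpace ℝ (Fin d)) = -EuclideanSpace.single i 1 := by
  have hnorm : ‖(w : EuclideanSpace ℝ (Fin d))‖ = 1 := norm_eq_of_mem_sphere w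
  obtain ⟨i, hi⟩ : ∃ i, (w : EuclideanSpace ℝ (Fin d)) i ≠ 0 := by
    by_contra! hall
    have : (w : EuclideanSpace ℝ (Fin d)) = 0 := by ext k; exact hall k
    simp [this] at hnorm
  have hw : (w : EuclideanSpace ℝ (Fin d))
      = EuclideanSpace.single i ((w : EuclideanSpace ℝ (Fin d)) i) := by
    ext k
    by_cases hk : k = i
    · simp [hk]
    · have := (mul_eq_zero.1 (h i k (Ne.symm hk))).resolve_left hi
      simp [hk, this]
  refine ⟨i, ?_⟩
  have habs : |(w : EuclideanSpace ℝ (Fin d)) i| = 1 := by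
    rwa [hw, PiLp.norm_single, Real.norm_eq_abs] at hnorm
  rcases eq_or_eq_neg_of_abs_eq habs with h1 | h1
  · left; rw [hw, h1]
  · right
    rw [hw, h1]
    ext k
    by_cases hk : k = i <;> simp [hk]

/-- The relations w_i w_j = 0 define a closed set of full λ-measure, which therefore contains the
support. -/
theorem IsExpTemperedStable.support_of_charFun_eq_prod (hμ : IsExpTemperedStable α β lam μ)
    (h : ∀ t, charFun μ t = ∏ i, charFun μ (EuclideanSpace.single i (t i))) :
    ∀ w ∈ lam.support, ∃ i : Fin d,
      (w : EuclideanSpace ℝ (Fin d)) = EuclideanSpace.single i 1 ∨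
      (w : EuclideanSpace ℝ (Fin d)) = -EuclideanSpace.single i 1 := by
  have hclosed : IsClosed {w : UnitSphere d | ∀ i j, i ≠ j →
      (w : EuclideanSpace ℝ (Fin d)) i * (w : EuclideanSpace ℝ (Fin d)) j = 0} := by
    simp only [Set.ofPred_forall]
    exact isClosed_iInter fun i => isClosed_iInter fun j => isClosed_iInter fun _ =>
      isClosed_eq (by fun_prop) (by fun_prop)
  have hae : {w : UnitSphere d | ∀ i j, i ≠ j →
      (w : EuclideanSpace ℝ (Fin d)) i * (w : EuclideanSpace ℝ (Fin d)) j = 0} ∈ ae lam := by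
    have : ∀ᵐ (w : UnitSphere d) ∂lam, ∀ i j, i ≠ j →
        (w : EuclideanSpace ℝ (Fin d)) i * (w : EuclideanSpace ℝ (Fin d)) j = 0 := by
      simp only [ae_all_iff]
      exact fun i j hij => hμ.ae_mul_eq_zero h hij
    exact this
  exact fun w hw => eq_single_of_mul_eq_zero w (Measure.support_subset_of_isClosed hclosed hae hw)

end Independence

theorem proposition2p5 {d : ℕ} (α : ℝ) (β : UnitSphere d → ℝ) (lam : Measure (UnitSphere d))
    (μ : Measure (EuclideanSpace ℝ (Fin d))) (hμ : IsExpTemperedStable α β lam μ) :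
    (μ ≪ (volume : Measure (EuclideanSpace ℝ (Fin d))) ↔
      ∃ w : Fin d → UnitSphere d, (∀ j, w j ∈ lam.support) ∧
        LinearIndependent ℝ (fun j => (w j : EuclideanSpace ℝ (Fin d)))) ∧
    (∀ {Ω : Type*} [MeasurableSpace Ω] (P : Measure Ω) [IsProbabilityMeasure P]
        (X : Ω → EuclideanSpace ℝ (Fin d)), HasLaw X μ P →
      (iIndepFun (fun i ω => X ω i) P ↔
        ∀ w ∈ lam.support, ∃ i : Fin d,
          (w : EuclideanSpace ℝ (Fin d)) = EuclideanSpace.single i 1 ∨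
          (w : EuclideanSpace ℝ (Fin d)) = -EuclideanSpace.single i 1)) := by
  refine ⟨⟨fun hac => exists_linearIndependent_of_span_eq_top (hμ.span_support_eq_top hac),
    fun ⟨w, hw, hli⟩ => hμ.absolutelyContinuous hw hli⟩, fun P _ X hX => ?_⟩
  rw [iIndepFun_iff_charFun_single hX]
  exact ⟨hμ.support_of_charFun_eq_prod, hμ.charFun_eq_prod_of_support⟩
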